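/- Let $M$ be a smooth $3$-dimensional manifold with a Riemannian metric $g$ and an almost contact metric structure $(\phi,\xi,\eta,g)$: $\phi$ is a smooth $(1,1)$-tensor field, $\xi$ a smooth vector field and $\eta$ a smooth $1$-form with $$\phi^2X=-X+\eta(X)\xi,\qquad \eta(\xi)=1,\qquad \phi\xi=0,\qquad \eta\circ\phi=0,\qquad g(\phi X,\phi Y)=g(X,Y)-\eta(X)\eta(Y).$$ Suppose that the structure is normal, i.e. $[\phi,\phi]+2\,d\eta\otimes\xi=0$, where $[\phi,\phi](X,Y)=\phi^2[X,Y]+[\phi X,\phi Y]-\phi[\phi X,Y]-\phi[X,\phi Y]$ and $2\,d\eta(X,Y)=X\eta(Y)-Y\eta(X)-\eta([X,Y])$, and that it is not cosymplectic (cosymplectic means: normal with $\eta$ and $\Phi(X,Y)=g(X,\phi Y)$ both closed). Let $\nabla$ be the Levi-Civita connection of $g$, and suppose that the functions $\alpha=\tfrac12\operatorname{div}\xi=\tfrac12\operatorname{tr}(X\mapsto\nabla_X\xi)$ and $\beta=\tfrac12\operatorname{tr}(X\mapsto\phi\nabla_X\xi)$ are constant on $M$. Suppose that $g$ is an almost Riemann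 soliton with potential vector field $\xi$, i.e. there is a smooth function $\lambda$ on $M$ such that $$2R+\lambda\, g\circledast g+g\circledast \mathcal L_\xi g=0,$$ where $R(X,Y,Z,W)=g(R(X,Y)Z,W)$ with $R(X,Y)Z=\nabla_X\nabla_YZ-\nabla_Y\nabla_XZ-\nabla_{[X,Y]}Z$, and $\circledast$ is the Kulkarni-Nomizu product $$(P\circledast Q)(X,Y,Z,W)=P(X,W)Q(Y,Z)+P(Y,Z)Q(X,W)-P(X,Z)Q(Y,W)-P(Y,W)Q(X,Z).$$ Then the almost Riemann soliton is a Riemann soliton: $\lambda$ is constant on $M$, and $g$ satisfies the displayed equation with that constant. -/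

import Mathlib

open Bundle VectorField
open scoped Manifold ContDiff

set_option linter.unusedSectionVars false

noncomputable section

namespace AlmostContact

section Connection

variable {E : Type*} [NormedAddCommGroup E] [NormedSpace ℝ E] [FiniteDimensional ℝ E]
  {H : Type*} [TopologicalSpace H] (I : ModelWithCorners ℝ E H)
  {M : Type*} [TopologicalSpace M] [ChartedSpace H M] [IsManifold I ∞ M]
  [RiemannianBundle (fun x : M ↦ TangentSpace I x)]
  [IsContMDiffRiemannianBundle I ∞ E (fun x : M ↦ TangentSpace I x)]

/-- The function `g(X, Y)` of two vector fields; the Riemannian metric `g` of `M` is the inner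
product on the tangent spaces, which varies smoothly with the base point. -/
def metricTensor (X Y : Π x : M, TangentSpace I x) (x : M) : ℝ := inner ℝ (X x) (Y x)

/-- The right-hand side of the Koszul formula for `g(∇_X Y, Z)`. -/
def koszul (X Y Z : Π x : M, TangentSpace I x) (x : M) : ℝ :=
  (1 / 2 : ℝ) * (mvfderiv I (metricTensor I Y Z) x (X x) + mvfderiv I (metricTensor I X Z) x (Y x)
    - mvfderiv I (metricTensor I X Y) x (Z x)
    + inner ℝ (mlieBracket I X Y x) (Z x) - inner ℝ (mlieBracket I X Z x) (Y x)
    - inner ℝ (mlieBracket I Y Z x) (X x))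

variable {I}

theorem mdiffAt_metricTensor {X Y : Π x : M, TangentSpace I x} {x : M}
    (hX : MDiffAt (T% X) x) (hY : MDiffAt (T% Y) x) : MDiffAt (metricTensor I X Y) x :=
  MDifferentiableAt.inner_bundle (E := fun x : M ↦ TangentSpace I x) hX hY

theorem metricTensor_comm (X Y : Π x : M, TangentSpace I x) :
    metricTensor I X Y = metricTensor I Y X := by
  ext x; exact real_inner_comm _ _

theorem metricTensor_smul_left (f : M → ℝ) (X Y : Π x : M, TangentSpace I x) :
    metricTensor I (f • X) Y = f * metricTensor I X Y := by
  ext x; simp [metricTensor, inner_smul_left]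

theorem metricTensor_smul_right (f : M → ℝ) (X Y : Π x : M, TangentSpace I x) :
    metricTensor I X (f • Y) = f * metricTensor I X Y := by
  ext x; simp [metricTensor, inner_smul_right]

theorem metricTensor_add_left (X X' Y : Π x : M, TangentSpace I x) :
    metricTensor I (X + X') Y = metricTensor I X Y + metricTensor I X' Y := by
  ext x; simp [metricTensor, inner_add_left]

theorem metricTensor_add_right (X Y Y' : Π x : M, TangentSpace I x) :
    metricTensor I X (Y + Y') = metricTensor I X Y + metricTensor I X Y' := by
  ext x; simp [metricTensor, inner_add_right]

theorem koszul_tensorial_left {Y Z : Π x : M, TangentSpace I x} {x : M}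
    (hY : MDiffAt (T% Y) x) (hZ : MDiffAt (T% Z) x) :
    TensorialAt I E (fun X : Π x : M, TangentSpace I x ↦ koszul I X Y Z x) x where
  smul {f X} hf hX := by
    have h1 := mdiffAt_metricTensor hX hY
    have h2 := mdiffAt_metricTensor hX hZ
    simp [koszul, metricTensor_smul_left, mvfderiv_mul hf h1, mvfderiv_mul hf h2,
      mlieBracket_smul_left hf hX, inner_add_left, inner_smul_left, inner_smul_right]
    simp [metricTensor, real_inner_comm]
    ring
  add {X X'} hX hX' := by
    simp [koszul, metricTensor_add_left,
      mvfderiv_add (mdiffAt_metricTensor hX hY) (mdiffAt_metricTensor hX' hY),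
      mvfderiv_add (mdiffAt_metricTensor hX hZ) (mdiffAt_metricTensor hX' hZ),
      mlieBracket_add_left hX hX', inner_add_left, inner_add_right]
    ring

theorem koszul_tensorial_right {X Y : Π x : M, TangentSpace I x} {x : M}
    (hX : MDiffAt (T% X) x) (hY : MDiffAt (T% Y) x) :
    TensorialAt I E (fun Z : Π x : M, TangentSpace I x ↦ koszul I X Y Z x) x where
  smul {f Z} hf hZ := by
    have h1 := mdiffAt_metricTensor hX hZ
    have h2 := mdiffAt_metricTensor hY hZ
    simp [koszul, metricTensor_smul_right, mvfderiv_mul hf h1, mvfderiv_mul hf h2,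
      mlieBracket_smul_right hf hZ, inner_add_left, inner_smul_left, inner_smul_right]
    simp [metricTensor, real_inner_comm]
    ring
  add {Z Z'} hZ hZ' := by
    simp [koszul, metricTensor_add_right,
      mvfderiv_add (mdiffAt_metricTensor hX hZ) (mdiffAt_metricTensor hX hZ'),
      mvfderiv_add (mdiffAt_metricTensor hY hZ) (mdiffAt_metricTensor hY hZ'),
      mlieBracket_add_right hZ hZ', inner_add_left, inner_add_right]
    ring

theorem koszul_add {X Y Y' Z : Π x : M, TangentSpace I x} {x : M}
    (hX : MDiffAt (T% X) x) (hY : MDiffAt (T% Y) x) (hY' : MDiffAt (T% Y') x)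
    (hZ : MDiffAt (T% Z) x) :
    koszul I X (Y + Y') Z x = koszul I X Y Z x + koszul I X Y' Z x := by
  simp [koszul, metricTensor_add_right, metricTensor_add_left,
    mvfderiv_add (mdiffAt_metricTensor hX hY) (mdiffAt_metricTensor hX hY'),
    mvfderiv_add (mdiffAt_metricTensor hY hZ) (mdiffAt_metricTensor hY' hZ),
    mlieBracket_add_right hY hY', mlieBracket_add_left hY hY', inner_add_left, inner_add_right]
  ring

theorem koszul_leibniz {X Y Z : Π x : M, TangentSpace I x} {f : M → ℝ} {x : M}
    (hX : MDiffAt (T% X) x) (hY : MDiffAt (T% Y) x) (hZ : MDiffAt (T% Z) x) (hf : MDiffAt f x) :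
    koszul I X (f • Y) Z x =
      f x * koszul I X Y Z x + mvfderiv I f x (X x) * inner ℝ (Y x) (Z x) := by
  simp [koszul, metricTensor_smul_right, metricTensor_smul_left,
    mvfderiv_mul hf (mdiffAt_metricTensor hX hY), mvfderiv_mul hf (mdiffAt_metricTensor hY hZ),
    mlieBracket_smul_right hf hY, mlieBracket_smul_left hf hY, inner_add_left, inner_smul_left,
    inner_smul_right]
  simp [metricTensor, real_inner_comm]
  ring



/-- The Koszul formula of a vector field `Y` differentiable at `x`, as a bilinear form on `T_xM`. -/
def koszulForm {Y : Π x : M, TangentSpace I x} {x : M} (hY : MDiffAt (T% Y) x) :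
    TangentSpace I x →L[ℝ] TangentSpace I x →L[ℝ] ℝ :=
  TensorialAt.mkHom₂ (fun X Z ↦ koszul I X Y Z x) x
    (fun _ hZ ↦ koszul_tensorial_left hY hZ) (fun _ hX ↦ koszul_tensorial_right hX hY)

theorem koszulForm_apply {X Y Z : Π x : M, TangentSpace I x} {x : M} (hX : MDiffAt (T% X) x)
    (hY : MDiffAt (T% Y) x) (hZ : MDiffAt (T% Z) x) :
    koszulForm hY (X x) (Z x) = koszul I X Y Z x :=
  TensorialAt.mkHom₂_apply _ _ hX hZ

instance instFiniteDimensionalTangentSpace (x : M) : FiniteDimensional ℝ (TangentSpace I x) :=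
  inferInstanceAs (FiniteDimensional ℝ E)

instance instCompleteSpaceTangentSpace (x : M) : CompleteSpace (TangentSpace I x) :=
  FiniteDimensional.complete ℝ _

/-- The endomorphism of `T_xM` which represents a bilinear form through the metric. -/
def sharp {x : M} (B : TangentSpace I x →L[ℝ] TangentSpace I x →L[ℝ] ℝ) :
    TangentSpace I x →L[ℝ] TangentSpace I x :=
  LinearMap.toContinuousLinearMap
    { toFun := fun v ↦ (InnerProductSpace.toDual ℝ (TangentSpace I x)).symm (B v)
      map_add' := fun v w ↦ by simp
      map_smul' := fun c v ↦ by simp }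

theorem inner_sharp {x : M} (B : TangentSpace I x →L[ℝ] TangentSpace I x →L[ℝ] ℝ)
    (v w : TangentSpace I x) : inner ℝ (sharp B v) w = B v w :=
  InnerProductSpace.toDual_symm_apply

open Classical in
variable (I) in
/-- The vector `(∇_X Y)(x)`, as a function of `X(x)`, for `Y` differentiable at `x`: it is determined
by `g(∇_X Y, Z)` being given by the Koszul formula. -/
def leviCivitaFun (Y : Π x : M, TangentSpace I x) (x : M) :
    TangentSpace I x →L[ℝ] TangentSpace I x :=
  if hY : MDiffAt (T% Y) x then sharp (koszulForm hY) else 0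

theorem inner_leviCivitaFun {X Y Z : Π x : M, TangentSpace I x} {x : M} (hX : MDiffAt (T% X) x)
    (hY : MDiffAt (T% Y) x) (hZ : MDiffAt (T% Z) x) :
    inner ℝ (leviCivitaFun I Y x (X x)) (Z x) = koszul I X Y Z x := by
  rw [leviCivitaFun, dif_pos hY, inner_sharp, koszulForm_apply hX hY hZ]

theorem endomorphism_ext {x : M} {A B : TangentSpace I x →L[ℝ] TangentSpace I x}
    (h : ∀ X Z : Π x : M, TangentSpace I x, MDiffAt (T% X) x → MDiffAt (T% Z) x →
      (inner ℝ (A (X x)) (Z x) : ℝ) = inner ℝ (B (X x)) (Z x)) : A = B := by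
  ext v
  refine ext_inner_right ℝ fun w ↦ ?_
  simpa using h _ _ (FiberBundle.mdifferentiableAt_extend I E v)
    (FiberBundle.mdifferentiableAt_extend I E w)

variable (I M) in
/-- The Levi-Civita connection `∇` of the Riemannian metric of `M`. In Mathlib's order of arguments,
`leviCivita I M Y x (X x)` is `(∇_X Y)(x)`. It is torsion-free and metric, as is proved below. -/
def leviCivita : CovariantDerivative I E (fun x : M ↦ TangentSpace I x) where
  toFun := leviCivitaFun I
  isCovariantDerivativeOnUniv :=
    { add := fun {Y Y' x} hY hY' _ ↦ by
        refine endomorphism_ext fun X Z hX hZ ↦ ?_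
        rw [add_apply, inner_add_left,
          inner_leviCivitaFun hX (mdifferentiableAt_add_section hY hY') hZ,
          inner_leviCivitaFun hX hY hZ, inner_leviCivitaFun hX hY' hZ, koszul_add hX hY hY' hZ]
      leibniz := fun {Y f x} hY hf _ ↦ by
        refine endomorphism_ext fun X Z hX hZ ↦ ?_
        rw [add_apply, inner_add_left,
          inner_leviCivitaFun hX (hf.smul_section hY) hZ, smul_apply,
          inner_smul_left, inner_leviCivitaFun hX hY hZ, koszul_leibniz hX hY hZ hf,
          ContinuousLinearMap.smulRight_apply, inner_smul_left]
        rfl }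

theorem inner_leviCivita {X Y Z : Π x : M, TangentSpace I x} {x : M} (hX : MDiffAt (T% X) x)
    (hY : MDiffAt (T% Y) x) (hZ : MDiffAt (T% Z) x) :
    inner ℝ (leviCivita I M Y x (X x)) (Z x) = koszul I X Y Z x :=
  inner_leviCivitaFun hX hY hZ

theorem leviCivita_torsion_free {X Y : Π x : M, TangentSpace I x} {x : M}
    (hX : MDiffAt (T% X) x) (hY : MDiffAt (T% Y) x) :
    leviCivita I M Y x (X x) - leviCivita I M X x (Y x) = mlieBracket I X Y x := by
  refine ext_inner_right ℝ fun w ↦ ?_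
  have hZ := FiberBundle.mdifferentiableAt_extend I E w
  have h1 := inner_leviCivita hX hY hZ
  have h2 := inner_leviCivita hY hX hZ
  simp only [FiberBundle.extend_apply_self] at h1 h2
  rw [inner_sub_left, h1, h2, koszul, koszul, mlieBracket_swap_apply (V := Y) (W := X),
    metricTensor_comm Y X, inner_neg_left]
  simp
  ring

theorem leviCivita_metric {X Y Z : Π x : M, TangentSpace I x} {x : M}
    (hX : MDiffAt (T% X) x) (hY : MDiffAt (T% Y) x) (hZ : MDiffAt (T% Z) x) :
    mvfderiv I (metricTensor I Y Z) x (X x) =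
      inner ℝ (leviCivita I M Y x (X x)) (Z x) + inner ℝ (Y x) (leviCivita I M Z x (X x)) := by
  rw [real_inner_comm (leviCivita I M Z x (X x)) (Y x), inner_leviCivita hX hY hZ,
    inner_leviCivita hX hZ hY, koszul, koszul, metricTensor_comm Z Y,
    mlieBracket_swap_apply (V := Z) (W := Y), inner_neg_left]
  ring

end Connection

section RiemannSoliton

variable {E : Type*} [NormedAddCommGroup E] [NormedSpace ℝ E] [FiniteDimensional ℝ E]
  {H : Type*} [TopologicalSpace H] (I : ModelWithCorners ℝ E H)
  {M : Type*} [TopologicalSpace M] [ChartedSpace H M] [IsManifold I ∞ M]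
  [RiemannianBundle (fun x : M ↦ TangentSpace I x)]
  [IsContMDiffRiemannianBundle I ∞ E (fun x : M ↦ TangentSpace I x)]

/-- The vector field `∇_X Y`. -/
def nabla (X Y : Π x : M, TangentSpace I x) (x : M) : TangentSpace I x :=
  leviCivita I M Y x (X x)

/-- The curvature `R(X, Y)Z = ∇_X ∇_Y Z - ∇_Y ∇_X Z - ∇_{[X, Y]} Z`. -/
def curvature (X Y Z : Π x : M, TangentSpace I x) (x : M) : TangentSpace I x :=
  nabla I X (nabla I Y Z) x - nabla I Y (nabla I X Z) x - nabla I (mlieBracket I X Y) Z x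

/-- The curvature as a `(0, 4)`-tensor, `R(X, Y, Z, W) = g(R(X, Y)Z, W)`. -/
def riemannTensor (X Y Z W : Π x : M, TangentSpace I x) (x : M) : ℝ :=
  metricTensor I (curvature I X Y Z) W x

/-- The Lie derivative of the metric,
`(𝓛_Z g)(X, Y) = Z(g(X, Y)) - g([Z, X], Y) - g(X, [Z, Y])`. -/
def lieDerivMetric (Z X Y : Π x : M, TangentSpace I x) (x : M) : ℝ :=
  mvfderiv I (metricTensor I X Y) x (Z x)
    - metricTensor I (mlieBracket I Z X) Y x - metricTensor I X (mlieBracket I Z Y) x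

/-- The Kulkarni-Nomizu product of two `(0, 2)`-tensors (given by their action on vector fields). -/
def kulkarniNomizu (P Q : (Π x : M, TangentSpace I x) → (Π x : M, TangentSpace I x) → M → ℝ)
    (X Y Z W : Π x : M, TangentSpace I x) (x : M) : ℝ :=
  P X W x * Q Y Z x + P Y Z x * Q X W x - P X Z x * Q Y W x - P Y W x * Q X Z x

/-- The tensor equation `2R + lam (g ∧ g) + g ∧ 𝓛_Z g = 0`, where `∧` is the Kulkarni-Nomizu
product. A tensor equation is tested at each point on the vector fields that are smooth near it. -/
def SolitonEquation (Z : Π x : M, TangentSpace I x) (lam : M → ℝ) : Prop :=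
  ∀ (x : M) (X Y V W : Π x : M, TangentSpace I x),
    CMDiffAt ∞ (T% X) x → CMDiffAt ∞ (T% Y) x → CMDiffAt ∞ (T% V) x → CMDiffAt ∞ (T% W) x →
    2 * riemannTensor I X Y V W x
      + lam x * kulkarniNomizu I (metricTensor I) (metricTensor I) X Y V W x
      + kulkarniNomizu I (metricTensor I) (lieDerivMetric I Z) X Y V W x = 0

/-- The metric of `M` is an almost Riemann soliton with potential vector field `Z` and soliton
function `lam`. -/
structure IsAlmostRiemannSoliton (Z : Π x : M, TangentSpace I x) (lam : M → ℝ) : Prop where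
  smooth_field : CMDiff ∞ (T% Z)
  smooth_function : CMDiff ∞ lam
  equation : SolitonEquation I Z lam

/-- The metric of `M` is a Riemann soliton with potential vector field `Z` and soliton
constant `c`. -/
structure IsRiemannSoliton (Z : Π x : M, TangentSpace I x) (c : ℝ) : Prop where
  smooth_field : CMDiff ∞ (T% Z)
  equation : SolitonEquation I Z (fun _ ↦ c)

end RiemannSoliton

section AlmostContactMetric

variable {E : Type*} [NormedAddCommGroup E] [NormedSpace ℝ E] [FiniteDimensional ℝ E]
  {H : Type*} [TopologicalSpace H] (I : ModelWithCorners ℝ E H)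
  (M : Type*) [TopologicalSpace M] [ChartedSpace H M] [IsManifold I ∞ M]
  [RiemannianBundle (fun x : M ↦ TangentSpace I x)]
  [IsContMDiffRiemannianBundle I ∞ E (fun x : M ↦ TangentSpace I x)]

/-- An almost contact metric structure `(φ, ξ, η, g)` on `M`, where `g` is the given Riemannian
metric of `M`: a smooth `(1, 1)`-tensor field `φ`, a smooth vector field `ξ` and a smooth 1-form
`η` with `φ² = -id + η ⊗ ξ`, `η(ξ) = 1`, `φξ = 0`, `η ∘ φ = 0` and
`g(φX, φY) = g(X, Y) - η(X) η(Y)`. -/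
structure AlmostContactMetricStructure where
  phi : Π x : M, TangentSpace I x →L[ℝ] TangentSpace I x
  xi : Π x : M, TangentSpace I x
  eta : Π x : M, TangentSpace I x →L[ℝ] ℝ
  contMDiff_phi : ContMDiff I (I.prod 𝓘(ℝ, E →L[ℝ] E)) ∞
    (fun x ↦ TotalSpace.mk' (E →L[ℝ] E)
      (E := fun x : M ↦ TangentSpace I x →L[ℝ] TangentSpace I x) x (phi x))
  contMDiff_xi : CMDiff ∞ (T% xi)
  contMDiff_eta : ContMDiff I (I.prod 𝓘(ℝ, E →L[ℝ] ℝ)) ∞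
    (fun x ↦ TotalSpace.mk' (E →L[ℝ] ℝ)
      (E := fun x : M ↦ TangentSpace I x →L[ℝ] Bundle.Trivial M ℝ x) x (eta x))
  phi_phi (x : M) (v : TangentSpace I x) : phi x (phi x v) = -v + eta x v • xi x
  eta_xi (x : M) : eta x (xi x) = 1
  phi_xi (x : M) : phi x (xi x) = 0
  eta_phi (x : M) (v : TangentSpace I x) : eta x (phi x v) = 0
  inner_phi_phi (x : M) (v w : TangentSpace I x) :
    (inner ℝ (phi x v) (phi x w) : ℝ) = inner ℝ v w - eta x v * eta x w

namespace AlmostContactMetricStructure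

variable {I M} (S : AlmostContactMetricStructure I M)

/-- The vector field `φX`. -/
def phiField (X : Π x : M, TangentSpace I x) (x : M) : TangentSpace I x := S.phi x (X x)

/-- The function `η(X)`. -/
def etaFun (X : Π x : M, TangentSpace I x) (x : M) : ℝ := S.eta x (X x)

/-- The Nijenhuis torsion
`[φ, φ](X, Y) = φ²[X, Y] + [φX, φY] - φ[φX, Y] - φ[X, φY]`. -/
def nijenhuis (X Y : Π x : M, TangentSpace I x) (x : M) : TangentSpace I x :=
  S.phi x (S.phi x (mlieBracket I X Y x)) + mlieBracket I (S.phiField X) (S.phiField Y) x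
    - S.phi x (mlieBracket I (S.phiField X) Y x) - S.phi x (mlieBracket I X (S.phiField Y) x)

/-- The exterior derivative `dη`, with the normalization
`2 dη(X, Y) = X(η(Y)) - Y(η(X)) - η([X, Y])` that is customary in contact metric geometry. -/
def dEta (X Y : Π x : M, TangentSpace I x) (x : M) : ℝ :=
  (1 / 2 : ℝ) * (mvfderiv I (S.etaFun Y) x (X x) - mvfderiv I (S.etaFun X) x (Y x)
    - S.eta x (mlieBracket I X Y x))

/-- The structure is normal: `[φ, φ] + 2 dη ⊗ ξ = 0`. -/
def IsNormal : Prop :=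
  ∀ (x : M) (X Y : Π x : M, TangentSpace I x), CMDiffAt ∞ (T% X) x → CMDiffAt ∞ (T% Y) x →
    S.nijenhuis X Y x + (2 * S.dEta X Y x) • S.xi x = 0

/-- The fundamental 2-form `Φ(X, Y) = g(X, φY)`. -/
def fundamentalForm (X Y : Π x : M, TangentSpace I x) : M → ℝ :=
  metricTensor I X (S.phiField Y)

/-- The exterior derivative `dΦ` of the fundamental 2-form, in the same normalization:
`3 dΦ(X, Y, Z)` is the cyclic sum of `X(Φ(Y, Z)) - Φ([X, Y], Z)`. -/
def dFundamentalForm (X Y Z : Π x : M, TangentSpace I x) (x : M) : ℝ :=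
  (1 / 3 : ℝ) * (mvfderiv I (S.fundamentalForm Y Z) x (X x)
    + mvfderiv I (S.fundamentalForm Z X) x (Y x) + mvfderiv I (S.fundamentalForm X Y) x (Z x)
    - S.fundamentalForm (mlieBracket I X Y) Z x - S.fundamentalForm (mlieBracket I Y Z) X x
    - S.fundamentalForm (mlieBracket I Z X) Y x)

/-- The structure is cosymplectic: it is normal, and `η` and `Φ` are closed. -/
structure IsCosymplectic : Prop where
  isNormal : S.IsNormal
  eta_closed : ∀ (x : M) (X Y : Π x : M, TangentSpace I x),
    CMDiffAt ∞ (T% X) x → CMDiffAt ∞ (T% Y) x → S.dEta X Y x = 0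
  fundamentalForm_closed : ∀ (x : M) (X Y Z : Π x : M, TangentSpace I x),
    CMDiffAt ∞ (T% X) x → CMDiffAt ∞ (T% Y) x → CMDiffAt ∞ (T% Z) x →
      S.dFundamentalForm X Y Z x = 0

/-- The endomorphism `X ↦ ∇_X ξ` of the tangent space. -/
def nablaXi (x : M) : TangentSpace I x →L[ℝ] TangentSpace I x := leviCivita I M S.xi x

/-- `α = (1/2) div ξ = (1/2) trace (X ↦ ∇_X ξ)`. -/
def alpha (x : M) : ℝ :=
  (1 / 2 : ℝ) * LinearMap.trace ℝ (TangentSpace I x) (S.nablaXi x).toLinearMap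

/-- `β = (1/2) trace (X ↦ φ(∇_X ξ))`. -/
def beta (x : M) : ℝ :=
  (1 / 2 : ℝ) *
    LinearMap.trace ℝ (TangentSpace I x) ((S.phi x).toLinearMap ∘ₗ (S.nablaXi x).toLinearMap)

end AlmostContactMetricStructure

end AlmostContactMetric

end AlmostContact

end

noncomputable section

namespace AlmostContact

section Algebra

variable {V : Type*} [NormedAddCommGroup V] [InnerProductSpace ℝ V]

/-- In dimension 3, every vector orthogonal to the Reeb vector is part of an adapted frame. -/
theorem exists_adapted_orthonormalBasis (hV : Module.finrank ℝ V = 3) (φ : V →ₗ[ℝ] V) (ξ : V)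
    (hξ : inner ℝ ξ ξ = (1 : ℝ)) (hφφ : ∀ v, φ (φ v) = -v + (inner ℝ ξ v : ℝ) • ξ)
    (hφξ : φ ξ = 0) (hφ : ∀ v w, (inner ℝ (φ v) w : ℝ) = -inner ℝ v (φ w)) :
    ∃ (e : V) (b : OrthonormalBasis (Fin 3) ℝ V), b 0 = e ∧ b 1 = φ e ∧ b 2 = ξ := by
  have : FiniteDimensional ℝ V := Module.finite_of_finrank_eq_succ hV
  have hξn : ‖ξ‖ = 1 := by
    rw [norm_eq_sqrt_real_inner, hξ, Real.sqrt_one]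
  obtain ⟨b, hb⟩ := Orthonormal.exists_orthonormalBasis_extension_of_card_eq (𝕜 := ℝ)
    (ι := Fin 3) (by simp [hV]) (v := fun _ ↦ ξ) (s := {2})
    ⟨fun _ ↦ hξn, fun i j hij ↦ absurd (Subsingleton.elim i j) hij⟩
  have hb2 : b 2 = ξ := hb 2 rfl
  have h0ξ : (inner ℝ ξ (b 0) : ℝ) = 0 := by
    rw [← hb2, b.inner_eq_ite]; simp
  have hee : (inner ℝ (b 0) (b 0) : ℝ) = 1 := by simp
  generalize b 0 = e at h0ξ hee
  have h1 : (inner ℝ e (φ e) : ℝ) = 0 := by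
    have := hφ e e
    rw [real_inner_comm] at this
    linarith
  have h2 : (inner ℝ (φ e) ξ : ℝ) = 0 := by rw [hφ, hφξ]; simp
  have h3 : (inner ℝ (φ e) (φ e) : ℝ) = 1 := by
    rw [hφ, hφφ, h0ξ]; simp only [zero_smul, add_zero, inner_neg_right, neg_neg, hee]
  have hon : Orthonormal ℝ ![e, φ e, ξ] := by
    rw [orthonormal_iff_ite]
    have h1' := (real_inner_comm e (φ e)).trans h1
    have h2' := (real_inner_comm (φ e) ξ).trans h2
    have h0' := (real_inner_comm ξ e).trans h0ξ
    intro i j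
    fin_cases i <;> fin_cases j <;>
      simp [hee, h1, h2, h3, h1', h2', h0', h0ξ, hξ, -inner_self_eq_norm_sq_to_K]
  obtain ⟨c, hc⟩ := Orthonormal.exists_orthonormalBasis_extension_of_card_eq (𝕜 := ℝ)
    (ι := Fin 3) (by simp [hV]) (v := ![e, φ e, ξ]) (s := Set.univ)
    (hon.comp _ Subtype.val_injective)
  exact ⟨e, c, by simpa using hc 0 trivial, by simpa using hc 1 trivial,
    by simpa using hc 2 trivial⟩

/-- An endomorphism of a 3-dimensional space with values in `ξ^⊥`, which kills `ξ` and has a skew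
commutator with `φ`, is determined by the traces of `A` and `φ A`. -/
theorem eq_of_skew_commutator (hV : Module.finrank ℝ V = 3) (φ A : V →ₗ[ℝ] V) (ξ : V)
    (hξ : inner ℝ ξ ξ = (1 : ℝ)) (hφφ : ∀ v, φ (φ v) = -v + (inner ℝ ξ v : ℝ) • ξ)
    (hφξ : φ ξ = 0) (hφ : ∀ v w, (inner ℝ (φ v) w : ℝ) = -inner ℝ v (φ w))
    (hAξ : A ξ = 0) (hξA : ∀ v, (inner ℝ ξ (A v) : ℝ) = 0)
    (hC : ∀ v, (inner ℝ (A (φ v) - φ (A v)) v : ℝ) = 0) (v : V) :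
    A v = ((1 / 2 : ℝ) * LinearMap.trace ℝ V A) • (v - (inner ℝ ξ v : ℝ) • ξ)
      - ((1 / 2 : ℝ) * LinearMap.trace ℝ V (φ ∘ₗ A)) • φ v := by
  have : FiniteDimensional ℝ V := Module.finite_of_finrank_eq_succ hV
  obtain ⟨e, b, hb0, hb1, hb2⟩ := exists_adapted_orthonormalBasis hV φ ξ hξ hφφ hφξ hφ
  have hξe : (inner ℝ ξ e : ℝ) = 0 := by rw [← hb2, ← hb0, b.inner_eq_ite]; simp
  have hee : (inner ℝ e e : ℝ) = 1 := by rw [← hb0, b.inner_eq_ite]; simp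
  have hff : (inner ℝ (φ e) (φ e) : ℝ) = 1 := by rw [← hb1, b.inner_eq_ite]; simp
  have hef : (inner ℝ e (φ e) : ℝ) = 0 := by
    rw [← hb1]; nth_rw 1 [← hb0]; rw [b.inner_eq_ite]; simp
  have hfe : (inner ℝ (φ e) e : ℝ) = 0 := (real_inner_comm _ _).trans hef
  have hξf : (inner ℝ ξ (φ e) : ℝ) = 0 := by rw [← hb1, ← hb2, b.inner_eq_ite]; simp
  have heξ : (inner ℝ e ξ : ℝ) = 0 := (real_inner_comm _ _).trans hξe
  have hfξ : (inner ℝ (φ e) ξ : ℝ) = 0 := (real_inner_comm _ _).trans hξf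
  have hφφe : φ (φ e) = -e := by rw [hφφ, hξe]; simp
  have hc1 := hC e
  have hc2 := hC (e + φ e)
  have hr : ∀ u w, (inner ℝ u (φ w) : ℝ) = -inner ℝ (φ u) w := fun u w ↦ by rw [hφ]; ring
  simp only [map_add, hφφe, map_neg, inner_add_left, inner_sub_left, inner_add_right, hφ,
    inner_neg_left, inner_neg_right] at hc1 hc2
  have htA : LinearMap.trace ℝ V A = inner ℝ e (A e) + inner ℝ (φ e) (A (φ e)) := by
    rw [LinearMap.trace_eq_sum_inner A b, Fin.sum_univ_three, hb0, hb1, hb2, hAξ]; simp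
  have htφ : LinearMap.trace ℝ V (φ ∘ₗ A) = -inner ℝ (φ e) (A e) + inner ℝ e (A (φ e)) := by
    rw [LinearMap.trace_eq_sum_inner _ b, Fin.sum_univ_three, hb0, hb1, hb2]
    simp [hAξ, hr, hφφe]
  have s1 := real_inner_comm e (A e)
  have s2 := real_inner_comm e (A (φ e))
  have s3 := real_inner_comm (φ e) (A e)
  have s4 := real_inner_comm (φ e) (A (φ e))
  suffices h : A = (((1 / 2 : ℝ) * LinearMap.trace ℝ V A) •
      (LinearMap.id - (innerₗ V ξ).smulRight ξ)
      - ((1 / 2 : ℝ) * LinearMap.trace ℝ V (φ ∘ₗ A)) • φ) by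
    simpa using LinearMap.congr_fun h v
  rw [htA, htφ]
  refine b.toBasis.ext fun i ↦ InnerProductSpace.ext_inner_left_basis b.toBasis fun j ↦ ?_
  fin_cases i <;> fin_cases j <;>
    simp [hb0, hb1, hb2, hAξ, hξA, hφξ, inner_sub_right, inner_add_right, inner_smul_right,
      hee, hff, hef, hfe, hξe, hξf, hξ, hφφe, -map_sub, -inner_self_eq_norm_sq_to_K] <;> linarith

end Algebra

namespace AlmostContactMetricStructure

variable {E : Type*} [NormedAddCommGroup E] [NormedSpace ℝ E] [FiniteDimensional ℝ E]
  {H : Type*} [TopologicalSpace H] {I : ModelWithCorners ℝ E H}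
  {M : Type*} [TopologicalSpace M] [ChartedSpace H M] [IsManifold I ∞ M]
  [RiemannianBundle (fun x : M ↦ TangentSpace I x)]
  [IsContMDiffRiemannianBundle I ∞ E (fun x : M ↦ TangentSpace I x)]
  (S : AlmostContactMetricStructure I M)

theorem inner_xi (x : M) (v : TangentSpace I x) : inner ℝ (S.xi x) v = S.eta x v := by
  have h := S.inner_phi_phi x (S.xi x) v
  rw [S.phi_xi, inner_zero_left, S.eta_xi] at h
  linarith

theorem inner_xi_xi (x : M) : (inner ℝ (S.xi x) (S.xi x) : ℝ) = 1 := by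
  rw [S.inner_xi, S.eta_xi]

theorem inner_phi (x : M) (v w : TangentSpace I x) :
    (inner ℝ (S.phi x v) w : ℝ) = -inner ℝ v (S.phi x w) := by
  have h := S.inner_phi_phi x v (S.phi x w)
  rw [S.phi_phi, S.eta_phi, inner_add_right, inner_neg_right, inner_smul_right,
    real_inner_comm (S.xi x) (S.phi x v), S.inner_xi, S.eta_phi] at h
  linarith

theorem inner_phi_self (x : M) (v : TangentSpace I x) : (inner ℝ (S.phi x v) v : ℝ) = 0 := by
  have h := S.inner_phi x v v
  rw [real_inner_comm (S.phi x v) v] at h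
  linarith

theorem etaFun_eq_metricTensor (X : Π x : M, TangentSpace I x) :
    S.etaFun X = metricTensor I S.xi X := by
  ext x; exact (S.inner_xi x _).symm

theorem mdiffAt_xi (x : M) : MDiffAt (T% S.xi) x :=
  (S.contMDiff_xi x).mdifferentiableAt (by simp)

theorem mdiffAt_phiField {X : Π x : M, TangentSpace I x} {x : M} (hX : CMDiffAt ∞ (T% X) x) :
    MDiffAt (T% (S.phiField X)) x :=
  ((S.contMDiff_phi x).clm_bundle_apply hX).mdifferentiableAt (by simp)

theorem inner_xi_nablaXi (x : M) (v : TangentSpace I x) :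
    (inner ℝ (S.xi x) (S.nablaXi x v) : ℝ) = 0 := by
  have h := leviCivita_metric (FiberBundle.mdifferentiableAt_extend I E v) (S.mdiffAt_xi x)
    (S.mdiffAt_xi x)
  have hc : metricTensor I S.xi S.xi = fun _ ↦ (1 : ℝ) := funext S.inner_xi_xi
  rw [hc, mvfderiv_const, FiberBundle.extend_apply_self, real_inner_comm] at h
  simp only [zero_apply] at h
  unfold nablaXi
  linarith

variable {S}

theorem IsNormal.lie_xi (hS : S.IsNormal) {X : Π x : M, TangentSpace I x} {x : M}
    (hX : CMDiffAt ∞ (T% X) x) :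
    mvfderiv I (S.etaFun X) x (S.xi x) + S.eta x (mlieBracket I X S.xi x) = 0 ∧
      mlieBracket I (S.phiField X) S.xi x = S.phi x (mlieBracket I X S.xi x) := by
  have hN := hS x X S.xi hX (S.contMDiff_xi x)
  have hφξ : S.phiField S.xi = 0 := funext S.phi_xi
  have hηξ : S.etaFun S.xi = fun _ ↦ (1 : ℝ) := funext S.eta_xi
  rw [nijenhuis, dEta, hφξ, hηξ, mlieBracket_zero_right, mlieBracket_zero_right, mvfderiv_const]
    at hN
  simp only [Pi.zero_apply, zero_apply, map_zero, add_zero, sub_zero] at hN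
  have h1 : ∀ {Y : Π x : M, TangentSpace I x}, CMDiffAt ∞ (T% Y) x →
      mvfderiv I (S.etaFun Y) x (S.xi x) + S.eta x (mlieBracket I Y S.xi x) = 0 := by
    intro Y hY
    have hN := hS x Y S.xi hY (S.contMDiff_xi x)
    rw [nijenhuis, dEta, hφξ, hηξ, mlieBracket_zero_right, mlieBracket_zero_right,
      mvfderiv_const] at hN
    have h := congrArg (S.eta x) hN
    simp only [Pi.zero_apply, zero_apply, map_zero, add_zero, sub_zero, map_add, map_sub,
      S.eta_phi, map_smul, S.eta_xi, smul_eq_mul] at h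
    linarith
  refine ⟨h1 hX, ?_⟩
  have h2 := h1 ((S.contMDiff_phi x).clm_bundle_apply hX)
  have hηφ : S.etaFun (S.phiField X) = fun _ ↦ (0 : ℝ) := funext fun y ↦ S.eta_phi y _
  change mvfderiv I (S.etaFun (S.phiField X)) x (S.xi x)
    + S.eta x (mlieBracket I (S.phiField X) S.xi x) = 0 at h2
  rw [hηφ, mvfderiv_const, zero_apply, zero_add] at h2
  have h3 := congrArg (S.phi x) hN
  simp only [map_zero, map_add, map_sub, map_smul, S.phi_xi, smul_zero, add_zero] at h3
  rw [S.phi_phi x (mlieBracket I (S.phiField X) S.xi x), h2, S.phi_phi x (S.phi x _),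
    S.eta_phi] at h3
  simp only [zero_smul, add_zero, sub_neg_eq_add] at h3
  rwa [neg_add_eq_sub, sub_eq_zero] at h3

theorem IsNormal.nablaXi_xi (hS : S.IsNormal) (x : M) : S.nablaXi x (S.xi x) = 0 := by
  refine ext_inner_right ℝ fun w ↦ ?_
  have hZ := FiberBundle.mdifferentiableAt_extend I E w
  have h1 := leviCivita_metric (S.mdiffAt_xi x) (S.mdiffAt_xi x) hZ
  have h2 := leviCivita_torsion_free hZ (S.mdiffAt_xi x)
  have h3 := (hS.lie_xi (FiberBundle.contMDiffAt_extend (k := ∞) I E w)).1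
  have h4 := S.inner_xi_nablaXi x w
  rw [← S.etaFun_eq_metricTensor] at h1
  rw [← h2, ← S.inner_xi, inner_sub_right, h1] at h3
  rw [FiberBundle.extend_apply_self] at h3
  unfold nablaXi at *
  simp only [inner_zero_left]
  linarith

theorem IsNormal.commutator_skew (hS : S.IsNormal) (x : M) (v : TangentSpace I x) :
    (inner ℝ (S.nablaXi x (S.phi x v) - S.phi x (S.nablaXi x v)) v : ℝ) = 0 := by
  have hs := FiberBundle.contMDiffAt_extend (k := ∞) I E v
  have hX := FiberBundle.mdifferentiableAt_extend I E v
  have hφX := S.mdiffAt_phiField hs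
  have h1 := leviCivita_metric (S.mdiffAt_xi x) hφX hX
  have h2 := leviCivita_torsion_free hX (S.mdiffAt_xi x)
  have h3 := leviCivita_torsion_free hφX (S.mdiffAt_xi x)
  have h4 := (hS.lie_xi hs).2
  have hc : metricTensor I (S.phiField (FiberBundle.extend E v)) (FiberBundle.extend E v) =
    fun _ ↦ (0 : ℝ) := funext fun y ↦ S.inner_phi_self y _
  rw [hc, mvfderiv_const] at h1
  rw [← h2, ← h3] at h4
  simp only [phiField, FiberBundle.extend_apply_self, zero_apply, map_sub] at h1 h4
  have h5 : S.nablaXi x (S.phi x v) - S.phi x (S.nablaXi x v) =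
      leviCivita I M (S.phiField (FiberBundle.extend E v)) x (S.xi x)
        - S.phi x (leviCivita I M (FiberBundle.extend E v) x (S.xi x)) := by
    unfold nablaXi
    rw [sub_eq_sub_iff_sub_eq_sub]
    exact h4
  rw [h5, inner_sub_left, S.inner_phi, real_inner_comm (S.phi x v)]
  linarith

/-- The covariant derivative of the Reeb field of a normal structure in dimension 3. -/
theorem IsNormal.nablaXi_eq (hS : S.IsNormal) (hE : Module.finrank ℝ E = 3) (x : M)
    (v : TangentSpace I x) :
    S.nablaXi x v = S.alpha x • (v - S.eta x v • S.xi x) - S.beta x • S.phi x v := by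
  have h := eq_of_skew_commutator (V := TangentSpace I x) hE (S.phi x).toLinearMap
    (S.nablaXi x).toLinearMap (S.xi x) (S.inner_xi_xi x)
    (fun v ↦ by simpa [S.inner_xi] using S.phi_phi x v) (S.phi_xi x) (S.inner_phi x)
    (hS.nablaXi_xi x) (S.inner_xi_nablaXi x) (hS.commutator_skew x) v
  simp only [S.inner_xi] at h
  exact h

/-- The curvature in a plane through `ξ` at a point, when `α` and `β` are constant. -/
theorem IsNormal.riemannTensor_xi (hS : S.IsNormal) (hE : Module.finrank ℝ E = 3) {a b : ℝ}
    (ha : ∀ x, S.alpha x = a) (hb : ∀ x, S.beta x = b) {X : Π x : M, TangentSpace I x} {x : M}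
    (hX : CMDiffAt ∞ (T% X) x) (hη : S.eta x (X x) = 0) (hX1 : (inner ℝ (X x) (X x) : ℝ) = 1) :
    riemannTensor I X S.xi S.xi X x = b ^ 2 - a ^ 2 := by
  have hA : ∀ (y : M) (v : TangentSpace I y),
      leviCivita I M S.xi y v = a • (v - S.eta y v • S.xi y) - b • S.phi y v := fun y v ↦ by
    rw [← ha y, ← hb y]; exact hS.nablaXi_eq hE y v
  have hXd : MDiffAt (T% X) x := hX.mdifferentiableAt (by simp)
  have hξd := S.mdiffAt_xi x
  have hηd : MDiffAt (S.etaFun X) x := by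
    rw [S.etaFun_eq_metricTensor]; exact mdiffAt_metricTensor hξd hXd
  have hgd := mdiffAt_metricTensor hXd hXd
  have hξξ : nabla I S.xi S.xi = 0 := funext fun y ↦ hS.nablaXi_xi y
  have hXξ : nabla I X S.xi = (fun _ : M ↦ a) • (X - S.etaFun X • S.xi)
      - (fun _ : M ↦ b) • S.phiField X := funext fun y ↦ hA y (X y)
  have hd : MDiffAt (T% (nabla I X S.xi)) x := by
    rw [hXξ]
    exact mdifferentiableAt_sub_section (mdifferentiableAt_const.smul_section
      (mdifferentiableAt_sub_section hXd (hηd.smul_section hξd)))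
      (mdifferentiableAt_const.smul_section (S.mdiffAt_phiField hX))
  have hm := leviCivita_metric hξd hd hXd
  have hf : metricTensor I (nabla I X S.xi) X =
      (fun _ : M ↦ a) * (metricTensor I X X - S.etaFun X * S.etaFun X) := by
    ext y
    rw [hXξ]
    simp only [metricTensor, etaFun, phiField, Pi.sub_apply, Pi.smul_apply', Pi.mul_apply,
      inner_sub_left, inner_smul_left, S.inner_phi_self, S.inner_xi]
    simp
  have hmg := leviCivita_metric hξd hXd hXd
  have hηx : S.etaFun X x = 0 := hη
  rw [hf, mvfderiv_mul mdifferentiableAt_const (hgd.sub (hηd.mul hηd)),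
    mvfderiv_sub hgd (hηd.mul hηd), mvfderiv_mul hηd hηd, mvfderiv_const, hηx] at hm
  have ht := leviCivita_torsion_free hXd hξd
  have hR : riemannTensor I X S.xi S.xi X x =
      -inner ℝ (leviCivita I M (nabla I X S.xi) x (S.xi x)) (X x)
        - inner ℝ (leviCivita I M S.xi x (mlieBracket I X S.xi x)) (X x) := by
    rw [riemannTensor, metricTensor, curvature, hξξ, nabla, nabla, nabla, CovariantDerivative.zero,
      inner_sub_left, inner_sub_left]
    simp
  have hNx : nabla I X S.xi x = a • X x - b • S.phi x (X x) := by
    rw [nabla, hA, hη, zero_smul, sub_zero]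
  rw [hR, ← ht]
  generalize leviCivita I M X x (S.xi x) = Y at *
  generalize inner ℝ (leviCivita I M (nabla I X S.xi) x (S.xi x)) (X x) = T at *
  simp only [hA, hNx, hη, S.phi_phi, S.eta_phi, S.inner_phi_self, inner_sub_left, map_sub,
    inner_smul_left, S.inner_xi, S.inner_phi, map_smul] at hm ⊢
  simp only [Pi.sub_apply, Pi.mul_apply, hηx, smul_apply, inner_neg_left, smul_eq_mul,
    zero_smul, smul_zero, zero_mul, add_zero, sub_zero, mul_zero, conj_trivial,
    mul_neg, sub_neg_eq_add, neg_zero, hX1, hmg] at hm ⊢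
  have hs := S.inner_phi x (X x) Y
  rw [real_inner_comm Y (S.phi x (X x))] at hs
  rw [real_inner_comm Y (X x)] at hm
  linear_combination hm + b * hs

theorem IsNormal.lieDerivMetric_self (hS : S.IsNormal) (hE : Module.finrank ℝ E = 3)
    {X : Π x : M, TangentSpace I x} {x : M} (hX : MDiffAt (T% X) x) :
    lieDerivMetric I S.xi X X x =
      2 * S.alpha x * (inner ℝ (X x) (X x) - S.eta x (X x) ^ 2) := by
  have h1 := leviCivita_metric (S.mdiffAt_xi x) hX hX
  have h2 := leviCivita_torsion_free (S.mdiffAt_xi x) hX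
  have h3 : leviCivita I M S.xi x (X x) = _ := hS.nablaXi_eq hE x (X x)
  rw [lieDerivMetric, h1, metricTensor, metricTensor, ← h2, h3]
  simp only [inner_sub_left, inner_sub_right, inner_smul_left, inner_smul_right, S.inner_xi,
    S.inner_phi_self, real_inner_comm (S.phi x (X x)) (X x), real_inner_comm (S.xi x) (X x)]
  simp
  ring

theorem IsNormal.soliton_function_eq (hS : S.IsNormal) (hE : Module.finrank ℝ E = 3) {a b : ℝ}
    (ha : ∀ x, S.alpha x = a) (hb : ∀ x, S.beta x = b) {lam : M → ℝ}
    (hlam : SolitonEquation I S.xi lam) (x : M) : lam x = a ^ 2 - b ^ 2 - a := by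
  obtain ⟨e, f, hf0, -, hf2⟩ := exists_adapted_orthonormalBasis (V := TangentSpace I x) hE
    (S.phi x).toLinearMap (S.xi x) (S.inner_xi_xi x)
    (fun v ↦ by simpa [S.inner_xi] using S.phi_phi x v) (S.phi_xi x) (S.inner_phi x)
  have hee : (inner ℝ e e : ℝ) = 1 := by rw [← hf0, f.inner_eq_ite]; simp
  have hξe : (inner ℝ (S.xi x) e : ℝ) = 0 := by rw [← hf2, ← hf0, f.inner_eq_ite]; simp
  have heξ : (inner ℝ e (S.xi x) : ℝ) = 0 := (real_inner_comm _ _).trans hξe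
  have hηe : S.eta x e = 0 := by rw [← S.inner_xi, hξe]
  have hX := FiberBundle.contMDiffAt_extend (k := ∞) I E e
  have hXx : FiberBundle.extend E e x = e := FiberBundle.extend_apply_self E e
  have h := hlam x _ S.xi S.xi _ hX (S.contMDiff_xi x) (S.contMDiff_xi x) hX
  rw [hS.riemannTensor_xi hE ha hb hX (by rw [hXx, hηe]) (by rw [hXx, hee])] at h
  simp only [kulkarniNomizu, hS.lieDerivMetric_self hE (S.mdiffAt_xi x),
    hS.lieDerivMetric_self hE (hX.mdifferentiableAt (by simp)), metricTensor, hXx, hee, heξ, hξe,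
    hηe, S.inner_xi_xi, S.eta_xi, ha] at h
  linarith

end AlmostContactMetricStructure

end AlmostContact

end

theorem corollary4p1
    (M : Type*) [TopologicalSpace M] [ChartedSpace (EuclideanSpace ℝ (Fin 3)) M]
    [IsManifold (𝓡 3) ∞ M]
    [RiemannianBundle (fun x : M ↦ TangentSpace (𝓡 3) x)]
    [IsContMDiffRiemannianBundle (𝓡 3) ∞ (EuclideanSpace ℝ (Fin 3))
      (fun x : M ↦ TangentSpace (𝓡 3) x)]
    (S : AlmostContact.AlmostContactMetricStructure (𝓡 3) M)
    (hnormal : S.IsNormal) (hcosymplectic : ¬ S.IsCosymplectic)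
    (halpha : ∃ a : ℝ, ∀ x : M, S.alpha x = a) (hbeta : ∃ b : ℝ, ∀ x : M, S.beta x = b)
    (lam : M → ℝ) (hsoliton : AlmostContact.IsAlmostRiemannSoliton (𝓡 3) S.xi lam) :
    ∃ c : ℝ, (∀ x : M, lam x = c) ∧ AlmostContact.IsRiemannSoliton (𝓡 3) S.xi c := by
  obtain ⟨a, ha⟩ := halpha
  obtain ⟨b, hb⟩ := hbeta
  have hc : ∀ x, lam x = a ^ 2 - b ^ 2 - a :=
    hnormal.soliton_function_eq finrank_euclideanSpace_fin ha hb hsoliton.equation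
  refine ⟨a ^ 2 - b ^ 2 - a, hc, S.contMDiff_xi, ?_⟩
  rw [← (funext hc : lam = fun _ ↦ a ^ 2 - b ^ 2 - a)]
  exact hsoliton.equation
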